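/- Let $k:\mathbb{Z}\to\mathbb{R}$ be a symmetric, positive definite function (that is, $k(-t)=k(t)$ and $\sum_{i,j}x_ix_jk(i-j)\ge 0$ for every finitely supported real family $(x_i)_{i\in\mathbb{Z}}$) such that $\sum_{t\in\mathbb{Z}}|k(t)|=M<+\infty$, and let $f(\lambda)=\sum_{t\in\mathbb{Z}}\mathrm{e}^{\mathrm{i}\lambda t}k(t)$ be its spectral density, a real-valued function of $\lambda\in\mathbb{R}$. Let $0\le\alpha<1/(2M)$ (with $1/(2M)=+\infty$ if $M=0$). Then $1+2\alpha f>0$, $\log(1+2\alpha f)$ is integrable on $[0,2\pi]$, and the equation $$g(s)+2\alpha\sum_{r=0}^{+\infty}g(r)\,k(s-r)=\delta_{s,0}\qquad(s\in\mathbb{Z})$$ has a unique solution $g$ in $L^1(\mathbb{Z})$ (the absolutely summable real functions on $\mathbb{Z}$). One has $$g(0)=\exp\left(-\frac{1}{2\pi}\int_0^{2\pi}\log(1+2\alpha f(\lambda))\,\mathrm{d}\lambda\right)$$ and $$\sum_{s=0}^{+\infty}g(s)=\exp\left(-\frac12\log(1+2\alpha f(0))-\frac{1}{4\pi}\int_0^{2\pi}\log(1+2\alpha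 f(\lambda))\,\mathrm{d}\lambda\right).$$ Moreover, for every integer $t\ge 0$ the system $$g_t(s)+2\alpha\sum_{r=0}^{t}g_t(r)\,k(s-r)=\delta_{s,0}\qquad(0\le s\le t)$$ has a unique solution $(g_t(s))_{0\le s\le t}$, and, as $t\to+\infty$, $g_t(s)\to g(s)$ for every $s\ge 0$, and $$\sum_{s=0}^{t}g_t(s)\to\sum_{s=0}^{+\infty}g(s).$$ -/

import Mathlib

/-- A symmetric function `k : ℤ → ℝ` of positive type (the covariance function of a stationary
sequence): `k (-t) = k t`, and `∑ i, j, x i * k (i - j) * x j ≥ 0` for every finitely supported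
real family `x`. Both facts say that the infinite matrix `(k (i - j))` is symmetric and positive
semidefinite. -/
def IsPositiveDefiniteSymm (k : ℤ → ℝ) : Prop :=
  (Matrix.of fun i j : ℤ => k (i - j)).PosSemidef

/-- The terms `e^{i λ t} k(t)` of the Fourier series of `k`. -/
noncomputable def spectralTerm (k : ℤ → ℝ) (l : ℝ) (t : ℤ) : ℂ :=
  Complex.exp (Complex.I * (l : ℂ) * (t : ℂ)) * (k t : ℂ)

/-- The spectral density `f(λ) = ∑_{t ∈ ℤ} e^{i λ t} k(t)`. For a symmetric summable `k` the sum
is real, so that taking the real part changes nothing (the theorem states this too). -/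
noncomputable def spectralDensity (k : ℤ → ℝ) (l : ℝ) : ℝ :=
  (∑' t : ℤ, spectralTerm k l t).re

/-- `g` solves the half-line equation
`g(s) + 2 α ∑_{r ≥ 0} g(r) k(s - r) = δ_{s,0}` for all `s ∈ ℤ`, with convergent series. -/
def IsHalfLineSolution (α : ℝ) (k g : ℤ → ℝ) : Prop :=
  ∀ s : ℤ, Summable (fun r : ℕ => g r * k (s - r)) ∧
    g s + 2 * α * ∑' r : ℕ, g r * k (s - r) = if s = 0 then 1 else 0

/-- `h = (h(0), …, h(t))` solves the truncated system
`h(s) + 2 α ∑_{r=0}^{t} h(r) k(s - r) = δ_{s,0}` for `0 ≤ s ≤ t`. -/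
def IsTruncatedSolution (α : ℝ) (k : ℤ → ℝ) (t : ℕ) (h : Fin (t + 1) → ℝ) : Prop :=
  ∀ s : Fin (t + 1),
    h s + 2 * α * ∑ r : Fin (t + 1), h r * k (((s : ℕ) : ℤ) - ((r : ℕ) : ℤ)) =
      if s = 0 then 1 else 0

/-! In the convolution algebra ℓ¹(ℤ), put a = 2αk, so that ‖a‖ = 2αM < 1. Then L = log(1 + a) exists
as a power series and its Fourier series is log(1 + 2αf). Split L = L₋ + L(0) + L₊ by the sign of
the index. The element u = e^{-L(0)} exp(-L₊) satisfies u(1 + a) = exp(L₋). Exponentials of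
one-sided sequences differ from the unit only on the same side (`exp_apply_of_notMem`), so u lives
on s ≥ 0 and u(1 + a) agrees with δ there: u is g on the half-line, and g = 1 - ua on all of ℤ.
Moreover u(0) = e^{-L(0)}, and L(0) is the mean of log(1 + 2αf). Since L is symmetric, L₋ and L₊
have the same sum, namely (log(1 + 2αf(0)) - L(0))/2, which gives the sum of u. The rest follows
from `norm_le_of_add_restrict_mul`: the maps x ↦ x + P(xa) are bounded below by 1 - ‖a‖, uniformly
over restrictions P. This yields uniqueness on the half-line, solvability of the finite systems, and
stability strong enough for convergence in ℓ¹ norm, hence pointwise and in sum. -/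

/-! ### Convolution on ℓ¹(ℤ) -/

/-- The absolutely summable real sequences indexed by `ℤ`, with convolution as product. -/
abbrev EllOne : Type := lp (fun _ : ℤ => ℝ) 1

theorem memℓp_one_iff {f : ℤ → ℝ} : Memℓp f 1 ↔ Summable fun t => |f t| := by
  simpa using memℓp_gen_iff (p := 1) (f := f) (by simp)

namespace EllOne

theorem summable_abs (a : EllOne) : Summable fun t => |a t| := memℓp_one_iff.1 a.2

theorem norm_eq (a : EllOne) : ‖a‖ = ∑' t, |a t| := by
  simpa using lp.norm_eq_tsum_rpow (p := 1) (by simp) a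

/-- The shear (r, s) ↦ (r, s - r) of ℤ × ℤ turns this into a product family. -/
theorem summable_mul_prod (a b : EllOne) :
    Summable fun p : ℤ × ℤ => ‖a p.1 * b (p.2 - p.1)‖ := by
  have h := a.summable_abs.mul_of_nonneg b.summable_abs (fun _ => abs_nonneg _)
    (fun _ => abs_nonneg _)
  have e : (fun p : ℤ × ℤ => ‖a p.1 * b (p.2 - p.1)‖) =
      (fun p : ℤ × ℤ => |a p.1| * |b p.2|) ∘
        (Equiv.prodShear (Equiv.refl ℤ) fun r : ℤ => Equiv.subRight r) := by
    ext p
    simp [Equiv.prodShear]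
  rw [e]
  exact (Equiv.summable_iff _).2 h

/-- Absolute values of the terms of a convolution, indexed with the output variable first. -/
theorem summable_mul_prod_swap (a b : EllOne) :
    Summable fun p : ℤ × ℤ => ‖a p.2 * b (p.1 - p.2)‖ :=
  (Equiv.summable_iff (Equiv.prodComm ℤ ℤ)).2 (a.summable_mul_prod b)

theorem summable_mul_sub (a b : EllOne) (s : ℤ) : Summable fun r => a r * b (s - r) :=
  ((a.summable_mul_prod_swap b).prod_factor s).of_norm

theorem tsum_tsum_norm_mul (a b : EllOne) :
    ∑' s, ∑' r, ‖a r * b (s - r)‖ = ‖a‖ * ‖b‖ := by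
  rw [← (a.summable_mul_prod_swap b).tsum_prod, norm_eq, norm_eq]
  rw [tsum_mul_tsum_of_summable_norm a.summable_abs.norm b.summable_abs.norm]
  rw [← (Equiv.prodComm ℤ ℤ).tsum_eq,
    ← (Equiv.prodShear (Equiv.refl ℤ) fun r : ℤ => Equiv.subRight r).tsum_eq
      (fun p : ℤ × ℤ => |a p.1| * |b p.2|)]
  simp [Equiv.prodShear]

theorem summable_abs_conv (a b : EllOne) : Summable fun s => |∑' r, a r * b (s - r)| := by
  refine Summable.of_nonneg_of_le (fun _ => abs_nonneg _) (fun s => ?_)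
    (a.summable_mul_prod_swap b).prod
  exact norm_tsum_le_tsum_norm ((a.summable_mul_prod_swap b).prod_factor s)

noncomputable instance : Mul EllOne :=
  ⟨fun a b => ⟨fun s => ∑' r, a r * b (s - r), memℓp_one_iff.2 (a.summable_abs_conv b)⟩⟩

noncomputable instance : One EllOne := ⟨lp.single (E := fun _ : ℤ => ℝ) 1 0 1⟩

theorem mul_apply (a b : EllOne) (s : ℤ) : (a * b) s = ∑' r, a r * b (s - r) := rfl

theorem one_apply (s : ℤ) : (1 : EllOne) s = if s = 0 then 1 else 0 := by
  change lp.single (E := fun _ : ℤ => ℝ) 1 0 1 s = _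
  rw [lp.single_apply, Pi.single_apply]

theorem norm_mul_le' (a b : EllOne) : ‖a * b‖ ≤ ‖a‖ * ‖b‖ := by
  rw [norm_eq, ← tsum_tsum_norm_mul]
  refine (a.summable_abs_conv b).tsum_le_tsum (fun s => ?_) (a.summable_mul_prod_swap b).prod
  exact norm_tsum_le_tsum_norm ((a.summable_mul_prod_swap b).prod_factor s)

/-! ### Fourier series as characters of ℓ¹(ℤ) -/

theorem norm_spectralTerm (k : ℤ → ℝ) (l : ℝ) (t : ℤ) : ‖spectralTerm k l t‖ = |k t| := by
  rw [spectralTerm, norm_mul, Complex.norm_real, Real.norm_eq_abs,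
    show Complex.I * (l : ℂ) * (t : ℂ) = ((l * t : ℝ) : ℂ) * Complex.I by push_cast; ring,
    Complex.norm_exp_ofReal_mul_I, one_mul]

theorem summable_norm_spectralTerm (a : EllOne) (l : ℝ) :
    Summable fun t => ‖spectralTerm a l t‖ := by
  simpa only [norm_spectralTerm] using a.summable_abs

/-- The Fourier series of an absolutely summable sequence. -/
noncomputable def fourier (l : ℝ) (a : EllOne) : ℂ := ∑' t, spectralTerm a l t

theorem hasSum_fourier (l : ℝ) (a : EllOne) : HasSum (spectralTerm a l) (fourier l a) :=
  (a.summable_norm_spectralTerm l).of_norm.hasSum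

theorem norm_fourier_le (l : ℝ) (a : EllOne) : ‖fourier l a‖ ≤ ‖a‖ := by
  rw [norm_eq, ← tsum_congr (norm_spectralTerm a l)]
  exact norm_tsum_le_tsum_norm (a.summable_norm_spectralTerm l)

theorem fourier_add (l : ℝ) (a b : EllOne) : fourier l (a + b) = fourier l a + fourier l b := by
  refine (hasSum_fourier l _).unique
    (((hasSum_fourier l a).add (hasSum_fourier l b)).congr_fun ?_)
  intro t
  simp [spectralTerm, mul_add]

theorem fourier_smul (l : ℝ) (c : ℝ) (a : EllOne) : fourier l (c • a) = c * fourier l a := by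
  refine (hasSum_fourier l _).unique (((hasSum_fourier l a).mul_left (c : ℂ)).congr_fun ?_)
  intro t
  simp [spectralTerm]
  ring

theorem fourier_one (l : ℝ) : fourier l 1 = 1 := by
  rw [fourier, tsum_eq_single 0]
  · simp [spectralTerm, one_apply]
  · intro t ht
    simp [spectralTerm, one_apply, ht]

theorem fourier_mul (l : ℝ) (a b : EllOne) : fourier l (a * b) = fourier l a * fourier l b := by
  have hs : Summable fun p : ℤ × ℤ => spectralTerm a l p.2 * spectralTerm b l (p.1 - p.2) := by
    refine Summable.of_norm ?_
    simpa only [norm_mul, norm_spectralTerm, Real.norm_eq_abs] using a.summable_mul_prod_swap b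
  calc fourier l (a * b) = ∑' s, ∑' r, spectralTerm a l r * spectralTerm b l (s - r) := by
        refine tsum_congr fun s => ?_
        simp only [spectralTerm, mul_apply, Complex.ofReal_tsum]
        rw [← tsum_mul_left]
        refine tsum_congr fun r => ?_
        rw [show Complex.I * (l : ℂ) * (s : ℂ) =
          Complex.I * l * r + Complex.I * l * ((s - r : ℤ) : ℂ) by push_cast; ring, Complex.exp_add]
        push_cast
        ring
    _ = ∑' p : ℤ × ℤ, spectralTerm a l p.2 * spectralTerm b l (p.1 - p.2) := hs.tsum_prod.symm
    _ = fourier l a * fourier l b := by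
        rw [fourier, fourier, tsum_mul_tsum_of_summable_norm (a.summable_norm_spectralTerm l)
          (b.summable_norm_spectralTerm l), ← (Equiv.prodComm ℤ ℤ).tsum_eq,
          ← (Equiv.prodShear (Equiv.refl ℤ) fun r : ℤ => Equiv.subRight r).tsum_eq
            (fun p : ℤ × ℤ => spectralTerm a l p.1 * spectralTerm b l p.2)]
        simp [Equiv.prodShear]

theorem continuous_spectralTerm (k : ℤ → ℝ) (t : ℤ) : Continuous fun l => spectralTerm k l t := by
  unfold spectralTerm
  fun_prop

theorem continuous_fourier (a : EllOne) : Continuous fun l => fourier l a :=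
  continuous_tsum (continuous_spectralTerm a) a.summable_abs fun t l =>
    (norm_spectralTerm a l t).le

theorem integral_exp_int (n : ℤ) :
    ∫ l in (0 : ℝ)..(2 * Real.pi), Complex.exp (Complex.I * l * n) =
      if n = 0 then 2 * Real.pi else 0 := by
  split_ifs with hn
  · simp [hn]
  · have hc : Complex.I * n ≠ 0 := mul_ne_zero Complex.I_ne_zero (Int.cast_ne_zero.2 hn)
    have h := integral_exp_mul_complex (a := 0) (b := 2 * Real.pi) hc
    rw [show (fun l : ℝ => Complex.exp (Complex.I * l * n)) =
      fun l : ℝ => Complex.exp (Complex.I * n * l) by ext l; congr 1; ring, h]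
    rw [show Complex.I * n * ((2 * Real.pi : ℝ) : ℂ) = n * (2 * Real.pi * Complex.I) by
      push_cast; ring, Complex.exp_int_mul_two_pi_mul_I]
    simp

/-- Termwise integration, dominated by |a t|, and orthogonality of the exponentials. -/
theorem integral_fourier (a : EllOne) (n : ℤ) :
    ∫ l in (0 : ℝ)..(2 * Real.pi), fourier l a * Complex.exp (Complex.I * l * (-n : ℤ)) =
      2 * Real.pi * a n := by
  have h := intervalIntegral.hasSum_integral_of_dominated_convergence (μ := MeasureTheory.volume)
    (a := 0) (b := 2 * Real.pi)
    (F := fun (t : ℤ) (l : ℝ) => spectralTerm a l t * Complex.exp (Complex.I * l * (-n : ℤ)))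
    (f := fun l => fourier l a * Complex.exp (Complex.I * l * (-n : ℤ)))
    (fun t _ => |a t|)
    (fun t => ((continuous_spectralTerm a t).mul (by fun_prop)).aestronglyMeasurable)
    (fun t => Filter.Eventually.of_forall fun l _ => by
      rw [norm_mul, norm_spectralTerm,
        show Complex.I * (l : ℂ) * ((-n : ℤ) : ℂ) = ((-(l * n) : ℝ) : ℂ) * Complex.I by
          push_cast; ring, Complex.norm_exp_ofReal_mul_I, mul_one])
    (Filter.Eventually.of_forall fun _ _ => a.summable_abs)
    intervalIntegrable_const
    (Filter.Eventually.of_forall fun l _ => (hasSum_fourier l a).mul_right _)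
  refine h.unique ?_
  have e : ∀ t : ℤ, ∫ l in (0 : ℝ)..(2 * Real.pi),
      spectralTerm a l t * Complex.exp (Complex.I * l * (-n : ℤ)) =
      if t = n then 2 * Real.pi * (a n : ℂ) else 0 := by
    intro t
    have : ∀ l : ℝ, spectralTerm a l t * Complex.exp (Complex.I * l * (-n : ℤ)) =
        Complex.exp (Complex.I * l * (t - n : ℤ)) * a t := by
      intro l
      rw [spectralTerm, mul_right_comm, ← Complex.exp_add]
      congr 2
      push_cast
      ring
    simp only [this, intervalIntegral.integral_mul_const, integral_exp_int, sub_eq_zero]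
    split_ifs with htn
    · rw [htn]
      push_cast
      rfl
    · simp
  simp only [e]
  exact hasSum_ite_eq n _

/-- Used to pull identities back from ℂ: the ring axioms below and the factorization are all checked
on Fourier series. -/
theorem fourier_injective {a b : EllOne} (h : ∀ l, fourier l a = fourier l b) : a = b := by
  refine lp.ext (funext fun n => ?_)
  have e : (2 * Real.pi * a n : ℂ) = 2 * Real.pi * b n := by
    rw [← integral_fourier, ← integral_fourier]
    simp only [h]
  have hp : (2 * Real.pi : ℂ) ≠ 0 := by exact_mod_cast Real.two_pi_pos.ne'
  exact_mod_cast mul_left_cancel₀ hp e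

theorem fourier_zero (l : ℝ) : fourier l 0 = 0 := by
  simpa using fourier_smul l 0 0

/-! ### Banach algebra structure and the exponential -/

noncomputable instance : CommRing EllOne :=
  { (inferInstance : AddCommGroup EllOne) with
    mul := (· * ·)
    one := 1
    left_distrib := fun a b c => fourier_injective fun l => by
      simp only [fourier_mul, fourier_add, mul_add]
    right_distrib := fun a b c => fourier_injective fun l => by
      simp only [fourier_mul, fourier_add, add_mul]
    zero_mul := fun a => fourier_injective fun l => by
      simp only [fourier_mul, fourier_zero, zero_mul]
    mul_zero := fun a => fourier_injective fun l => by
      simp only [fourier_mul, fourier_zero, mul_zero]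
    mul_assoc := fun a b c => fourier_injective fun l => by
      simp only [fourier_mul, mul_assoc]
    one_mul := fun a => fourier_injective fun l => by
      simp only [fourier_mul, fourier_one, one_mul]
    mul_one := fun a => fourier_injective fun l => by
      simp only [fourier_mul, fourier_one, mul_one]
    mul_comm := fun a b => fourier_injective fun l => by
      simp only [fourier_mul, mul_comm] }

noncomputable instance : NormedCommRing EllOne :=
  { (inferInstance : NormedAddCommGroup EllOne), (inferInstance : CommRing EllOne) with
    norm_mul_le := norm_mul_le' }

noncomputable instance : NormedAlgebra ℝ EllOne :=
  { Algebra.ofModule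
      (fun c a b => fourier_injective fun l => by
        simp only [fourier_mul, fourier_smul, mul_assoc])
      (fun c a b => fourier_injective fun l => by
        simp only [fourier_mul, fourier_smul, mul_left_comm]) with
    norm_smul_le := fun c a => norm_smul_le c a }

/-- The Fourier series at `l` as a homomorphism of algebras. -/
noncomputable def fourierHom (l : ℝ) : EllOne →ₐ[ℝ] ℂ :=
  AlgHom.ofLinearMap
    { toFun := fourier l
      map_add' := fourier_add l
      map_smul' := fun c a => by simp [fourier_smul] }
    (fourier_one l) (fourier_mul l)

theorem fourierHom_apply (l : ℝ) (a : EllOne) : fourierHom l a = fourier l a := rfl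

theorem continuous_fourierHom (l : ℝ) : Continuous (fourierHom l) :=
  (fourierHom l).toLinearMap.mkContinuous 1 (fun a =>
    (norm_fourier_le l a).trans_eq (one_mul _).symm) |>.continuous

theorem fourier_exp (l : ℝ) (a : EllOne) :
    fourier l (NormedSpace.exp a) = Complex.exp (fourier l a) := by
  have h := NormedSpace.map_exp_of_mem_ball (𝕂 := ℝ) (fourierHom l) (continuous_fourierHom l) a
    (by rw [NormedSpace.expSeries_radius_eq_top]; exact edist_lt_top _ _)
  rw [Complex.exp_eq_exp_ℂ]
  exact h

theorem continuous_eval (t : ℤ) : Continuous fun a : EllOne => a t :=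
  (lp.lipschitzWith_one_eval (E := fun _ : ℤ => ℝ) 1 t).continuous

/-- If t = r + (t - r) is outside the additively closed S, one of the two summands is outside S. -/
theorem mul_apply_eq_zero {S : Set ℤ} (hS : ∀ s ∈ S, ∀ t ∈ S, s + t ∈ S) {x y : EllOne}
    (hx : ∀ t ∉ S, x t = 0) (hy : ∀ t ∉ S, y t = 0) {t : ℤ} (ht : t ∉ S) : (x * y) t = 0 := by
  rw [mul_apply]
  refine (tsum_congr fun r => ?_).trans tsum_zero
  by_cases hr : r ∈ S
  · rw [hy, mul_zero]
    intro h
    exact ht (by simpa using hS _ hr _ h)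
  · rw [hx r hr, zero_mul]

theorem pow_succ_apply_eq_zero {S : Set ℤ} (hS : ∀ s ∈ S, ∀ t ∈ S, s + t ∈ S) {x : EllOne}
    (hx : ∀ t ∉ S, x t = 0) (n : ℕ) {t : ℤ} (ht : t ∉ S) : (x ^ (n + 1)) t = 0 := by
  induction n generalizing t with
  | zero => simpa using hx t ht
  | succ n ih =>
    rw [pow_succ]
    exact mul_apply_eq_zero hS (fun t ht => ih ht) hx ht

/-- If `x` is supported in an additively closed set, so is `exp x - 1`. -/
theorem exp_apply_of_notMem {S : Set ℤ} (hS : ∀ s ∈ S, ∀ t ∈ S, s + t ∈ S) {x : EllOne}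
    (hx : ∀ t ∉ S, x t = 0) {t : ℤ} (ht : t ∉ S) :
    (NormedSpace.exp x) t = (1 : EllOne) t := by
  have h := NormedSpace.exp_series_hasSum_exp' (𝕂 := ℝ) x
  have h' : HasSum (fun n : ℕ => ((n.factorial : ℝ)⁻¹ • x ^ n : EllOne) t)
      ((NormedSpace.exp x) t) :=
    h.map ((Pi.evalAddMonoidHom (fun _ : ℤ => ℝ) t).comp (lp.coeFnAddMonoidHom _ 1))
      (continuous_eval t)
  refine h'.unique ?_
  have e := hasSum_single (f := fun n : ℕ => ((n.factorial : ℝ)⁻¹ • x ^ n : EllOne) t) 0 ?_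
  · simpa using e
  · intro n hn
    obtain ⟨m, rfl⟩ := Nat.exists_eq_succ_of_ne_zero hn
    rw [lp.coeFn_smul, Pi.smul_apply, Nat.succ_eq_add_one, pow_succ_apply_eq_zero hS hx m ht,
      smul_zero]

/-- The part of a sequence supported in `S`. -/
noncomputable def restrict (S : Set ℤ) (a : EllOne) : EllOne :=
  ⟨S.indicator a, memℓp_one_iff.2 <| by
    exact Summable.of_nonneg_of_le (fun _ => abs_nonneg _)
      (fun _ => norm_indicator_le_norm_self (f := ⇑a) (s := S) _) a.summable_abs⟩

theorem restrict_apply (S : Set ℤ) (a : EllOne) (t : ℤ) : restrict S a t = S.indicator a t := rfl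

theorem restrict_apply_of_notMem {S : Set ℤ} (a : EllOne) {t : ℤ} (ht : t ∉ S) :
    restrict S a t = 0 := Set.indicator_of_notMem ht _

theorem eq_restrict_add (a : EllOne) :
    a = restrict {t | t < 0} a + a 0 • (1 : EllOne) + restrict {t | 0 < t} a := by
  refine lp.ext (funext fun t => ?_)
  simp only [lp.coeFn_add, lp.coeFn_smul, Pi.add_apply, Pi.smul_apply, one_apply, restrict_apply,
    Set.indicator_apply, Set.mem_ofPred_eq, smul_eq_mul]
  rcases lt_trichotomy t 0 with h | rfl | h
  · simp [h, h.ne, h.le]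
  · simp
  · simp [h, h.ne', h.le]

/-! ### Logarithm and symmetry -/

/-- The logarithm of `1 + a`, for `‖a‖ < 1`, as a power series. -/
noncomputable def logOneAdd (a : EllOne) : EllOne :=
  ∑' n : ℕ, ((-1 : ℝ) ^ (n + 1) / n) • a ^ n

theorem fourier_logOneAdd {a : EllOne} (ha : ‖a‖ < 1) (l : ℝ) :
    fourier l (logOneAdd a) = Complex.log (1 + fourier l a) := by
  have hs : Summable fun n : ℕ => ((-1 : ℝ) ^ (n + 1) / n) • a ^ n := by
    refine Summable.of_norm_bounded (summable_norm_geometric_of_norm_lt_one ha) fun n => ?_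
    rw [norm_smul]
    refine mul_le_of_le_one_left (norm_nonneg _) ?_
    -- At n = 0 the coefficient is a division by zero, so it vanishes as the logarithm series
    -- requires.
    rcases n.eq_zero_or_pos with rfl | hn
    · simp
    · rw [norm_div, norm_pow, norm_neg, norm_one, one_pow, Real.norm_natCast]
      exact div_le_one_of_le₀ (by exact_mod_cast hn) (Nat.cast_nonneg _)
  have h := hs.hasSum.map (fourierHom l) (continuous_fourierHom l)
  refine h.unique ((Complex.hasSum_taylorSeries_log
    ((norm_fourier_le l a).trans_lt ha)).congr_fun fun n => ?_)
  simp only [Function.comp_apply, map_smul, map_pow, fourierHom_apply, Complex.real_smul]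
  push_cast
  ring

theorem fourier_eq_ofReal {a : EllOne} (ha : ∀ t, a (-t) = a t) (l : ℝ) :
    fourier l a = (spectralDensity a l : ℂ) := by
  have h : (starRingEnd ℂ) (fourier l a) = fourier l a := by
    rw [fourier, Complex.conj_tsum, ← (Equiv.neg ℤ).tsum_eq]
    refine tsum_congr fun t => ?_
    simp only [spectralTerm, Equiv.neg_apply, ha, map_mul, Complex.conj_ofReal,
      ← Complex.exp_conj, Complex.conj_I, map_intCast]
    congr 2
    push_cast
    ring
  exact (Complex.conj_eq_iff_re.1 h).symm

/-- The sequence `t ↦ a (-t)`. -/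
noncomputable def reflect (a : EllOne) : EllOne :=
  ⟨fun t => a (-t), memℓp_one_iff.2 ((Equiv.neg ℤ).summable_iff.2 a.summable_abs)⟩

theorem fourier_reflect (l : ℝ) (a : EllOne) : fourier l (reflect a) = fourier (-l) a := by
  rw [fourier, ← (Equiv.neg ℤ).tsum_eq]
  refine tsum_congr fun t => ?_
  simp [spectralTerm, reflect]

theorem reflect_logOneAdd {a : EllOne} (ha : ‖a‖ < 1) (hs : ∀ t, a (-t) = a t) :
    reflect (logOneAdd a) = logOneAdd a := by
  have hr : reflect a = a := lp.ext (funext hs)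
  refine fourier_injective fun l => ?_
  rw [fourier_reflect, fourier_logOneAdd ha, fourier_logOneAdd ha, ← fourier_reflect, hr]

/-- Reflection exchanges the two halves of a symmetric sequence and preserves sums. -/
theorem fourier_zero_restrict_neg {a : EllOne} (ha : reflect a = a) :
    fourier 0 (restrict {t | t < 0} a) = fourier 0 (restrict {t | 0 < t} a) := by
  have h : reflect (restrict {t | 0 < t} a) = restrict {t | t < 0} a := by
    refine lp.ext (funext fun t => ?_)
    have hat : a (-t) = a t := congrFun (congrArg Subtype.val ha) t
    change Set.indicator _ _ (-t) = Set.indicator _ _ t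
    simp [Set.indicator_apply, hat]
  rw [← h, fourier_reflect, neg_zero]

theorem abs_spectralDensity_le (a : EllOne) (l : ℝ) : |spectralDensity a l| ≤ ‖a‖ :=
  (Complex.abs_re_le_norm _).trans (norm_fourier_le l a)

theorem one_add_spectralDensity_pos {a : EllOne} (ha : ‖a‖ < 1) (l : ℝ) :
    0 < 1 + spectralDensity a l := by
  linarith [(abs_le.1 (a.abs_spectralDensity_le l)).1]

theorem continuous_spectralDensity (a : EllOne) : Continuous (spectralDensity a) :=
  Complex.continuous_re.comp a.continuous_fourier

theorem fourier_logOneAdd_ofReal {a : EllOne} (ha : ‖a‖ < 1) (hs : ∀ t, a (-t) = a t) (l : ℝ) :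
    fourier l (logOneAdd a) = (Real.log (1 + spectralDensity a l) : ℂ) := by
  rw [fourier_logOneAdd ha, fourier_eq_ofReal hs,
    Complex.ofReal_log (one_add_spectralDensity_pos ha l).le]
  push_cast
  rfl

theorem logOneAdd_apply_zero {a : EllOne} (ha : ‖a‖ < 1) (hs : ∀ t, a (-t) = a t) :
    logOneAdd a 0 = 1 / (2 * Real.pi) *
      ∫ l in (0 : ℝ)..(2 * Real.pi), Real.log (1 + spectralDensity a l) := by
  have h := integral_fourier (logOneAdd a) 0
  simp only [fourier_logOneAdd_ofReal ha hs, neg_zero, Int.cast_zero, mul_zero, Complex.exp_zero,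
    mul_one, intervalIntegral.integral_ofReal] at h
  have h' : (∫ l in (0 : ℝ)..(2 * Real.pi), Real.log (1 + spectralDensity a l)) =
      2 * Real.pi * logOneAdd a 0 := by exact_mod_cast h
  rw [h']
  field_simp

/-! ### Wiener–Hopf factorization -/

/-- Wiener–Hopf factorization: the solution `u` on the half-line of `u * (1 + a) = 1` up to
negative indices. -/
noncomputable def wienerHopf (a : EllOne) : EllOne :=
  Real.exp (-logOneAdd a 0) • NormedSpace.exp (-restrict {t | 0 < t} (logOneAdd a))

theorem wienerHopf_mul {a : EllOne} (ha : ‖a‖ < 1) :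
    wienerHopf a * (1 + a) = NormedSpace.exp (restrict {t | t < 0} (logOneAdd a)) := by
  refine fourier_injective fun l => ?_
  have hne : 1 + fourier l a ≠ 0 := by
    intro h
    have := (norm_fourier_le l a).trans_lt ha
    rw [eq_neg_of_add_eq_zero_right h, norm_neg, norm_one] at this
    exact lt_irrefl _ this
  have hL := congrArg (fourier l) (eq_restrict_add (logOneAdd a))
  rw [fourier_logOneAdd ha, fourier_add, fourier_add, fourier_smul, fourier_one, mul_one] at hL
  have hneg : ∀ x : EllOne, fourier l (-x) = -fourier l x := fun x => map_neg (fourierHom l) x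
  rw [wienerHopf, fourier_mul, fourier_smul, fourier_exp, fourier_exp, hneg, fourier_add,
    fourier_one, ← Complex.exp_log hne, hL, Complex.ofReal_exp, ← Complex.exp_add,
    ← Complex.exp_add]
  congr 1
  push_cast
  ring

theorem neg_restrict_apply_of_notMem {S : Set ℤ} (a : EllOne) {t : ℤ} (ht : t ∉ S) :
    (-restrict S a) t = 0 := by
  rw [lp.coeFn_neg, Pi.neg_apply, restrict_apply_of_notMem a ht, neg_zero]

theorem wienerHopf_apply_of_nonpos (a : EllOne) {t : ℤ} (ht : t ≤ 0) :
    wienerHopf a t = Real.exp (-logOneAdd a 0) * (1 : EllOne) t := by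
  rw [wienerHopf, lp.coeFn_smul, Pi.smul_apply, smul_eq_mul,
    exp_apply_of_notMem (S := {t | 0 < t})
      (fun s hs t ht => by simp only [Set.mem_ofPred_eq] at *; omega)
      (fun t ht => neg_restrict_apply_of_notMem _ ht) (by simpa using ht)]

theorem wienerHopf_mul_apply {a : EllOne} (ha : ‖a‖ < 1) {t : ℤ} (ht : 0 ≤ t) :
    (wienerHopf a * (1 + a)) t = (1 : EllOne) t := by
  rw [wienerHopf_mul ha, exp_apply_of_notMem (S := {t | t < 0})
      (fun s hs t ht => by simp only [Set.mem_ofPred_eq] at *; omega)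
      (fun t ht => restrict_apply_of_notMem _ ht) (by simpa using ht)]

theorem fourier_zero_wienerHopf {a : EllOne} (ha : ‖a‖ < 1) (hs : ∀ t, a (-t) = a t) :
    fourier 0 (wienerHopf a) =
      (Real.exp (-(1 / 2) * Real.log (1 + spectralDensity a 0) - 1 / 2 * logOneAdd a 0) : ℂ) := by
  have hL := congrArg (fourier 0) (eq_restrict_add (logOneAdd a))
  rw [fourier_logOneAdd_ofReal ha hs, fourier_add, fourier_add, fourier_smul, fourier_one,
    -- Now log(1 + f(0)) equals L(0) plus twice the sum of L₊.
    mul_one, fourier_zero_restrict_neg (reflect_logOneAdd ha hs)] at hL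
  have hneg : ∀ x : EllOne, fourier 0 (-x) = -fourier 0 x := fun x => map_neg (fourierHom 0) x
  rw [wienerHopf, fourier_smul, fourier_exp, hneg, Complex.ofReal_exp, Complex.ofReal_exp,
    ← Complex.exp_add]
  congr 1
  push_cast
  rw [hL]
  ring

/-- The full-line extension of `wienerHopf a` that the half-line equation prescribes. -/
noncomputable def halfLineSolution (a : EllOne) : EllOne := 1 - wienerHopf a * a

theorem halfLineSolution_apply_of_nonneg {a : EllOne} (ha : ‖a‖ < 1) {t : ℤ} (ht : 0 ≤ t) :
    halfLineSolution a t = wienerHopf a t := by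
  have h := wienerHopf_mul_apply ha ht
  rw [mul_add, mul_one, lp.coeFn_add, Pi.add_apply] at h
  rw [halfLineSolution, lp.coeFn_sub, Pi.sub_apply]
  linarith

/-! ### Restrictions and the half-line equation -/

open Filter Topology

theorem norm_restrict_le (S : Set ℤ) (a : EllOne) : ‖restrict S a‖ ≤ ‖a‖ := by
  rw [norm_eq, norm_eq]
  exact (restrict S a).summable_abs.tsum_le_tsum
    (fun _ => norm_indicator_le_norm_self (f := ⇑a) (s := S) _) a.summable_abs

theorem restrict_add (S : Set ℤ) (a b : EllOne) :
    restrict S (a + b) = restrict S a + restrict S b :=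
  lp.ext (Set.indicator_add S a b)

theorem restrict_sub (S : Set ℤ) (a b : EllOne) :
    restrict S (a - b) = restrict S a - restrict S b :=
  lp.ext (Set.indicator_sub S a b)

/-- The operators `x ↦ x + P (x * a)`, with `P` the restriction to `S`, are bounded below. -/
theorem norm_le_of_add_restrict_mul {S : Set ℤ} {a x b : EllOne} (ha : ‖a‖ < 1)
    (h : x + restrict S (x * a) = b) : ‖x‖ ≤ (1 - ‖a‖)⁻¹ * ‖b‖ := by
  have h1 : ‖x‖ ≤ ‖b‖ + ‖x‖ * ‖a‖ := by
    calc ‖x‖ = ‖b - restrict S (x * a)‖ := by rw [← h, add_sub_cancel_right]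
      _ ≤ ‖b‖ + ‖restrict S (x * a)‖ := norm_sub_le _ _
      _ ≤ ‖b‖ + ‖x‖ * ‖a‖ := by
        gcongr
        exact (norm_restrict_le _ _).trans (norm_mul_le _ _)
  rw [← div_eq_inv_mul, le_div_iff₀ (sub_pos.2 ha)]
  linarith

theorem tsum_eq_tsum_nat {f : ℤ → ℝ} (hf : ∀ r < 0, f r = 0) : ∑' r, f r = ∑' r : ℕ, f r := by
  refine (Nat.cast_injective (R := ℤ).tsum_eq fun r hr => ?_).symm
  have : 0 ≤ r := not_lt.1 fun h => hr (hf r h)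
  exact ⟨r.toNat, Int.toNat_of_nonneg this⟩

theorem restrict_nonneg_mul_apply (g a : EllOne) (s : ℤ) :
    (restrict {t | 0 ≤ t} g * a) s = ∑' r : ℕ, g r * a (s - r) := by
  rw [mul_apply, tsum_eq_tsum_nat]
  · simp [restrict_apply]
  · intro r hr
    rw [restrict_apply_of_notMem g (by simpa using hr), zero_mul]

theorem isHalfLineSolution_iff (α : ℝ) (K G : EllOne) :
    IsHalfLineSolution α K G ↔
      G + restrict {t | 0 ≤ t} G * ((2 * α) • K) = 1 := by
  have e : ∀ s, (G + restrict {t | 0 ≤ t} G * ((2 * α) • K)) s =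
      G s + 2 * α * ∑' r : ℕ, G r * K (s - r) := by
    intro s
    rw [mul_smul_comm, lp.coeFn_add, lp.coeFn_smul, Pi.add_apply, Pi.smul_apply, smul_eq_mul,
      restrict_nonneg_mul_apply]
  constructor
  · intro h
    refine lp.ext (funext fun s => ?_)
    rw [e, (h s).2, one_apply]
  · intro h s
    refine ⟨(G.summable_mul_sub K s).comp_injective Nat.cast_injective, ?_⟩
    rw [← e, h, one_apply]

/-- Restricted to s ≥ 0, the equation for the difference is closed in its own nonnegative part,
which the lower bound kills; the equation then determines the negative indices. -/
theorem isHalfLineSolution_unique {α : ℝ} {K G G' : EllOne} (ha : ‖(2 * α) • K‖ < 1)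
    (h : IsHalfLineSolution α K G) (h' : IsHalfLineSolution α K G') : G' = G := by
  rw [isHalfLineSolution_iff] at h h'
  set a := (2 * α) • K
  have hd : G' - G + restrict {t | 0 ≤ t} (G' - G) * a = 0 := by
    rw [restrict_sub, sub_mul, ← sub_eq_zero.2 (h'.trans h.symm)]
    ring
  have hP : restrict {t | 0 ≤ t} (restrict {t | 0 ≤ t} (G' - G)) = restrict {t | 0 ≤ t} (G' - G) :=
    lp.ext ((Set.indicator_indicator _ _ _).trans (by rw [Set.inter_self]; rfl))
  have hr : restrict {t | 0 ≤ t} (G' - G) +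
      restrict {t | 0 ≤ t} (restrict {t | 0 ≤ t} (G' - G) * a) = 0 := by
    rw [← restrict_add, hd]
    exact lp.ext (Set.indicator_zero' _)
  have h0 : restrict {t | 0 ≤ t} (G' - G) = 0 := by
    simpa using norm_le_of_add_restrict_mul ha hr
  rw [h0, zero_mul, add_zero] at hd
  exact sub_eq_zero.1 hd

theorem restrict_halfLineSolution {a : EllOne} (ha : ‖a‖ < 1) :
    restrict {t | 0 ≤ t} (halfLineSolution a) = wienerHopf a := by
  refine lp.ext (funext fun t => ?_)
  rw [restrict_apply]
  by_cases ht : 0 ≤ t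
  · rw [Set.indicator_of_mem (by exact ht), halfLineSolution_apply_of_nonneg ha ht]
  · rw [Set.indicator_of_notMem (by exact ht), wienerHopf_apply_of_nonpos a (by omega), one_apply,
      if_neg (by omega), mul_zero]

theorem isHalfLineSolution_halfLineSolution {α : ℝ} {K : EllOne} (ha : ‖(2 * α) • K‖ < 1) :
    IsHalfLineSolution α K (halfLineSolution ((2 * α) • K)) := by
  rw [isHalfLineSolution_iff, restrict_halfLineSolution ha, halfLineSolution, sub_add_cancel]

theorem fourier_zero_eq (a : EllOne) (h : ∀ t < 0, a t = 0) :
    fourier 0 a = ((∑' s : ℕ, a s : ℝ) : ℂ) := by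
  rw [← tsum_eq_tsum_nat h, Complex.ofReal_tsum, fourier]
  exact tsum_congr fun t => by simp [spectralTerm]

/-! ### Truncated systems and their limit -/

/-- The restriction to `{0, …, t}` of an arbitrary sequence. -/
noncomputable def truncate (t : ℕ) (f : ℤ → ℝ) : EllOne :=
  ⟨(Set.Icc 0 (t : ℤ)).indicator f, memℓp_one_iff.2 <|
    summable_of_hasFiniteSupport <| (Set.finite_Icc 0 (t : ℤ)).subset fun s hs => by
      by_contra h
      exact hs (by simp [Set.indicator_of_notMem h])⟩

theorem truncate_apply (t : ℕ) (f : ℤ → ℝ) (s : ℤ) :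
    truncate t f s = (Set.Icc 0 (t : ℤ)).indicator f s := rfl

theorem truncate_natCast {t s : ℕ} (f : ℤ → ℝ) (hs : s ≤ t) : truncate t f s = f s :=
  Set.indicator_of_mem (Set.mem_Icc.2 ⟨by positivity, by exact_mod_cast hs⟩) _

theorem truncate_mul_apply (t : ℕ) (f : ℤ → ℝ) (a : EllOne) (s : ℤ) :
    (truncate t f * a) s = ∑ r ∈ Finset.range (t + 1), f r * a (s - r) := by
  rw [mul_apply, tsum_eq_tsum_nat, tsum_eq_sum (s := Finset.range (t + 1))]
  · refine Finset.sum_congr rfl fun r hr => ?_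
    rw [truncate_natCast f (by simpa [Nat.lt_succ_iff] using hr)]
  · intro r hr
    rw [truncate_apply, Set.indicator_of_notMem, zero_mul]
    simp at hr ⊢
    omega
  · intro r hr
    rw [truncate_apply, Set.indicator_of_notMem, zero_mul]
    simp [hr]

theorem truncated_system_iff (α : ℝ) (K : EllOne) (t : ℕ) (f b : ℤ → ℝ) :
    (∀ s : Fin (t + 1), f (s : ℕ) + 2 * α * ∑ r : Fin (t + 1),
        f (r : ℕ) * K (((s : ℕ) : ℤ) - ((r : ℕ) : ℤ)) = b (s : ℕ)) ↔
      truncate t f + restrict (Set.Icc 0 (t : ℤ)) (truncate t f * ((2 * α) • K)) =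
        truncate t b := by
  have e : ∀ s ≤ t, (truncate t f + restrict (Set.Icc 0 (t : ℤ))
      (truncate t f * ((2 * α) • K))) (s : ℤ) =
      f s + 2 * α * ∑ r : Fin (t + 1), f (r : ℕ) * K ((s : ℤ) - ((r : ℕ) : ℤ)) := by
    intro s hs
    rw [mul_smul_comm, lp.coeFn_add, Pi.add_apply, truncate_natCast f hs, restrict_apply,
      Set.indicator_of_mem (Set.mem_Icc.2 ⟨by positivity, by exact_mod_cast hs⟩), lp.coeFn_smul, Pi.smul_apply,
      smul_eq_mul, truncate_mul_apply, Finset.sum_range fun r : ℕ => f r * K (s - r)]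
  constructor
  · intro h
    refine lp.ext (funext fun s => ?_)
    by_cases hs : s ∈ Set.Icc 0 (t : ℤ)
    · lift s to ℕ using hs.1
      have hst : s ≤ t := by exact_mod_cast hs.2
      rw [e s hst, truncate_natCast b hst]
      exact h ⟨s, Nat.lt_succ_of_le hst⟩
    · rw [lp.coeFn_add, Pi.add_apply, truncate_apply, truncate_apply, restrict_apply,
        Set.indicator_of_notMem hs, Set.indicator_of_notMem hs, Set.indicator_of_notMem hs,
        add_zero]
  · intro h s
    have hs := Nat.lt_succ_iff.1 s.2
    rw [← e s hs, h, truncate_natCast b hs]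

theorem truncate_zero (t : ℕ) : truncate t 0 = 0 := lp.ext (Set.indicator_zero' _)

theorem truncate_one (t : ℕ) : truncate t (fun s => if s = 0 then 1 else 0) = 1 := by
  refine lp.ext (funext fun s => ?_)
  rw [truncate_apply, one_apply, Set.indicator_apply]
  split_ifs with h h' h'
  · rfl
  · rfl
  · simp [h'] at h
  · rfl

theorem isTruncatedSolution_iff (α : ℝ) (K : EllOne) (t : ℕ) (f : ℤ → ℝ) :
    IsTruncatedSolution α K t (fun s => f (s : ℕ)) ↔
      truncate t f + restrict (Set.Icc 0 (t : ℤ)) (truncate t f * ((2 * α) • K)) = 1 := by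
  rw [← truncate_one t, ← truncated_system_iff]
  refine forall_congr' fun s => ?_
  simp only [Int.natCast_eq_zero, Fin.val_eq_zero_iff]

/-- A square linear system: the lower bound gives injectivity, and finite dimension does the rest.
-/
theorem existsUnique_isTruncatedSolution {α : ℝ} {K : EllOne} (ha : ‖(2 * α) • K‖ < 1) (t : ℕ) :
    ∃! h : Fin (t + 1) → ℝ, IsTruncatedSolution α K t h := by
  let A : Matrix (Fin (t + 1)) (Fin (t + 1)) ℝ :=
    1 + (2 * α) • Matrix.of fun s r : Fin (t + 1) => K (((s : ℕ) : ℤ) - ((r : ℕ) : ℤ))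
  have hA : ∀ h s, A.mulVecLin h s =
      h s + 2 * α * ∑ r : Fin (t + 1), h r * K (((s : ℕ) : ℤ) - ((r : ℕ) : ℤ)) := by
    intro h s
    rw [Matrix.mulVecLin_apply, Matrix.add_mulVec, Matrix.one_mulVec, Matrix.smul_mulVec,
      Pi.add_apply, Pi.smul_apply, smul_eq_mul]
    simp only [Matrix.mulVec, dotProduct, Matrix.of_apply, mul_comm]
  have hinj : Function.Injective A.mulVecLin := by
    rw [injective_iff_map_eq_zero]
    intro h h0
    -- Any extension of `h` to ℤ would do: `truncate` discards the values outside {0, …, t}.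
    let f : ℤ → ℝ := fun z => h (Fin.ofNat (t + 1) z.toNat)
    have hf : ∀ s : Fin (t + 1), f (s : ℕ) = h s := fun s => by simp [f]
    have key := (truncated_system_iff α K t f 0).1 fun s => by
      simp only [hf]
      rw [← hA, h0]
      rfl
    have hz := norm_le_of_add_restrict_mul ha key
    rw [truncate_zero, norm_zero, mul_zero, norm_le_zero_iff] at hz
    ext s
    rw [← hf, ← truncate_natCast f (Nat.lt_succ_iff.1 s.2), hz]
    rfl
  have hbij : Function.Bijective A.mulVecLin :=
    ⟨hinj, LinearMap.injective_iff_surjective.1 hinj⟩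
  have hiff : ∀ h, IsTruncatedSolution α K t h ↔
      A.mulVecLin h = fun s => if s = 0 then 1 else 0 := by
    intro h
    rw [funext_iff]
    simp only [hA, IsTruncatedSolution]
  simpa only [hiff] using hbij.existsUnique _

theorem tendsto_restrict_Icc {u : EllOne} (hu : ∀ t < 0, u t = 0) :
    Tendsto (fun t : ℕ => ‖u - restrict (Set.Icc 0 (t : ℤ)) u‖) atTop (𝓝 0) := by
  have hval : ∀ (t : ℕ) (s : ℤ), (u - restrict (Set.Icc 0 (t : ℤ)) u) s =
      u s - (Set.Icc 0 (t : ℤ)).indicator u s := fun _ _ => rfl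
  simp only [norm_eq, hval]
  rw [← tsum_zero (α := ℝ) (β := ℤ)]
  refine tendsto_tsum_of_dominated_convergence u.summable_abs (fun s => ?_)
    (Eventually.of_forall fun t s => ?_)
  · refine tendsto_const_nhds.congr' ?_
    filter_upwards [eventually_ge_atTop s.toNat] with t ht
    by_cases hs : s < 0
    · simp [Set.indicator_apply, hu s hs]
    · rw [Set.indicator_of_mem (Set.mem_Icc.2 ⟨not_lt.1 hs, by omega⟩), sub_self, abs_zero]
  · by_cases hs : s ∈ Set.Icc 0 (t : ℤ)
    · simp [hs]
    · simp [Set.indicator_of_notMem hs]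

theorem tendsto_truncated {a : EllOne} (ha : ‖a‖ < 1) {h : ℕ → EllOne}
    (hh : ∀ t : ℕ, h t + restrict (Set.Icc 0 (t : ℤ)) (h t * a) = 1) :
    Tendsto h atTop (𝓝 (wienerHopf a)) := by
  set u := wienerHopf a with hu_def
  have hu : ∀ t < 0, u t = 0 := fun t ht => by
    rw [hu_def, wienerHopf_apply_of_nonpos a ht.le, one_apply, if_neg ht.ne, mul_zero]
  have hub : ∀ t : ℕ, restrict (Set.Icc 0 (t : ℤ)) u + restrict (Set.Icc 0 (t : ℤ)) (u * a) = 1 := by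
    intro t
    rw [← restrict_add]
    refine lp.ext (funext fun s => ?_)
    rw [restrict_apply, Set.indicator_apply]
    split_ifs with hs
    · rw [← wienerHopf_mul_apply ha hs.1, mul_add, mul_one]
    · rw [one_apply, if_neg]
      rintro rfl
      simp at hs
  refine tendsto_iff_norm_sub_tendsto_zero.2 ?_
  have hlim : Tendsto (fun t : ℕ => ((1 - ‖a‖)⁻¹ + 1) *
      ‖u - restrict (Set.Icc 0 (t : ℤ)) u‖) atTop (𝓝 0) := by
    simpa using (tendsto_restrict_Icc hu).const_mul ((1 - ‖a‖)⁻¹ + 1)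
  refine squeeze_zero (fun _ => norm_nonneg _) (fun t => ?_) hlim
  set P := restrict (Set.Icc 0 (t : ℤ)) with hP
  -- The error solves the truncated system with the discarded tail of `u` as its source, so the
  -- uniform bound applies.
  have hd : (h t - P u) + P ((h t - P u) * a) = P ((u - P u) * a) := by
    rw [sub_mul, sub_mul, hP, restrict_sub, restrict_sub]
    linear_combination hh t - hub t
  have h1 := norm_le_of_add_restrict_mul ha hd
  have h2 : ‖P ((u - P u) * a)‖ ≤ ‖u - P u‖ :=
    (norm_restrict_le _ _).trans ((norm_mul_le _ _).trans
      (mul_le_of_le_one_right (norm_nonneg _) ha.le))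
  have h3 : 0 ≤ (1 - ‖a‖)⁻¹ := inv_nonneg.2 (sub_nonneg.2 ha.le)
  calc ‖h t - u‖ = ‖(h t - P u) - (u - P u)‖ := by rw [sub_sub_sub_cancel_right]
    _ ≤ ‖h t - P u‖ + ‖u - P u‖ := norm_sub_le _ _
    _ ≤ (1 - ‖a‖)⁻¹ * ‖u - P u‖ + ‖u - P u‖ := by
      gcongr
      exact h1.trans (mul_le_mul_of_nonneg_left h2 h3)
    _ = ((1 - ‖a‖)⁻¹ + 1) * ‖u - P u‖ := by ring

end EllOne

/-! ### The main theorem -/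

theorem proposition3 (k : ℤ → ℝ) (hk : IsPositiveDefiniteSymm k)
    (M : ℝ) (hM : HasSum (fun t : ℤ => |k t|) M)
    (α : ℝ) (hα : 0 ≤ α) (hαM : 2 * M * α < 1) :
    -- the spectral density is a well-defined real function and the logarithms make sense
    (∀ l : ℝ, HasSum (spectralTerm k l) (spectralDensity k l : ℂ)) ∧
    (∀ l : ℝ, 0 < 1 + 2 * α * spectralDensity k l) ∧
    IntervalIntegrable (fun l : ℝ => Real.log (1 + 2 * α * spectralDensity k l))
      MeasureTheory.volume 0 (2 * Real.pi) ∧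
    -- the truncated systems have unique solutions
    (∀ t : ℕ, ∃! h : Fin (t + 1) → ℝ, IsTruncatedSolution α k t h) ∧
    ∃ g : ℤ → ℝ,
      -- `g` is the unique solution in `L¹(ℤ)`
      (Memℓp g 1 ∧ IsHalfLineSolution α k g) ∧
      (∀ g' : ℤ → ℝ, Memℓp g' 1 → IsHalfLineSolution α k g' → g' = g) ∧
      -- its value at `0` and its sum over the half-line
      g 0 = Real.exp (-(1 / (2 * Real.pi)) *
        ∫ l in (0 : ℝ)..(2 * Real.pi), Real.log (1 + 2 * α * spectralDensity k l)) ∧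
      HasSum (fun s : ℕ => g s)
        (Real.exp (-(1 / 2) * Real.log (1 + 2 * α * spectralDensity k 0) -
          (1 / (4 * Real.pi)) *
            ∫ l in (0 : ℝ)..(2 * Real.pi), Real.log (1 + 2 * α * spectralDensity k l))) ∧
      -- convergence of the truncated solutions, pointwise and in sum
      ∀ gt : ℕ → ℕ → ℝ,
        (∀ t : ℕ, IsTruncatedSolution α k t (fun s : Fin (t + 1) => gt t s)) →
        (∀ s : ℕ, Filter.Tendsto (fun t : ℕ => gt t s) Filter.atTop (nhds (g s))) ∧
        Filter.Tendsto (fun t : ℕ => ∑ s ∈ Finset.range (t + 1), gt t s) Filter.atTop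
          (nhds (∑' s : ℕ, g s)) := by
  let K : EllOne := ⟨k, memℓp_one_iff.2 hM.summable⟩
  have hKk : ∀ t, K t = k t := fun _ => rfl
  have hsym : ∀ t, k (-t) = k t := by
    intro t
    simpa using hk.isHermitian.apply t 0
  set a : EllOne := (2 * α) • K with ha_def
  have ha : ‖a‖ < 1 := by
    have hK : ‖K‖ = M := (EllOne.norm_eq K).trans hM.tsum_eq
    rw [ha_def, norm_smul, hK, Real.norm_of_nonneg (by positivity)]
    linarith
  have has : ∀ t, a (-t) = a t := fun t => congrArg (2 * α * ·) (hsym t)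
  have hf : ∀ l, spectralDensity a l = 2 * α * spectralDensity k l := by
    intro l
    have h := EllOne.fourier_smul l (2 * α) K
    rw [EllOne.fourier_eq_ofReal (a := K) hsym, ← ha_def, EllOne.fourier_eq_ofReal has] at h
    exact_mod_cast h
  have hL0 := EllOne.logOneAdd_apply_zero ha has
  have hpos := EllOne.one_add_spectralDensity_pos ha
  have hcont : Continuous fun l => Real.log (1 + spectralDensity a l) :=
    (continuous_const.add a.continuous_spectralDensity).log fun l => (hpos l).ne'
  have hsum := EllOne.fourier_zero_wienerHopf ha has
  have hu : ∀ t < 0, EllOne.wienerHopf a t = 0 := fun t ht => by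
    rw [EllOne.wienerHopf_apply_of_nonpos a ht.le, EllOne.one_apply, if_neg ht.ne, mul_zero]
  have hgu : ∀ s : ℕ, EllOne.halfLineSolution a s = EllOne.wienerHopf a s := fun s =>
    EllOne.halfLineSolution_apply_of_nonneg ha (by positivity)
  simp only [hf] at hL0 hpos hcont hsum
  refine ⟨fun l => ?_, hpos, hcont.intervalIntegrable _ _,
    EllOne.existsUnique_isTruncatedSolution (K := K) ha, EllOne.halfLineSolution a,
    ⟨(EllOne.halfLineSolution a).2, EllOne.isHalfLineSolution_halfLineSolution (K := K) ha⟩,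
    fun g' hg' hsol => ?_, ?_, ?_, fun gt hgt => ?_⟩
  · rw [← EllOne.fourier_eq_ofReal (a := K) hsym]
    exact EllOne.hasSum_fourier l K
  · exact congrArg Subtype.val (EllOne.isHalfLineSolution_unique (K := K) (G' := ⟨g', hg'⟩) ha
      (EllOne.isHalfLineSolution_halfLineSolution ha) hsol)
  · rw [EllOne.halfLineSolution_apply_of_nonneg ha le_rfl,
      EllOne.wienerHopf_apply_of_nonpos a le_rfl, EllOne.one_apply, if_pos rfl, mul_one, hL0,
      neg_mul]
  · rw [EllOne.fourier_zero_eq _ hu, Complex.ofReal_inj, hL0] at hsum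
    have hs : Summable fun s : ℕ => EllOne.wienerHopf a s :=
      (EllOne.wienerHopf a).summable_abs.of_abs.comp_injective Nat.cast_injective
    simp only [hgu]
    convert hs.hasSum using 1
    rw [hsum]
    congr 2
    field_simp
    ring
  · have htr : ∀ t s : ℕ, s ≤ t →
        EllOne.truncate t (fun z => gt t z.toNat) s = gt t s := fun t s hs => by
      rw [EllOne.truncate_natCast _ hs, Int.toNat_natCast]
    have hlim := EllOne.tendsto_truncated ha (h := fun t => EllOne.truncate t fun z => gt t z.toNat)
      fun t => (EllOne.isTruncatedSolution_iff α K t _).1 (by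
        simpa only [Int.toNat_natCast] using hgt t)
    constructor
    · intro s
      rw [hgu]
      refine (((EllOne.continuous_eval s).tendsto _).comp hlim).congr' ?_
      filter_upwards [Filter.eventually_ge_atTop s] with t ht
      exact htr t s ht
    -- Summation is the Fourier series at 0, which is continuous on ℓ¹.
    · have h := (Complex.continuous_re.tendsto _).comp
        (((EllOne.continuous_fourierHom 0).tendsto _).comp hlim)
      simp only [EllOne.fourierHom_apply, EllOne.fourier_zero_eq _ hu, Complex.ofReal_re] at h
      simp only [hgu]
      refine h.congr fun t => ?_
      have hneg : ∀ s < 0, EllOne.truncate t (fun z => gt t z.toNat) s = 0 := fun s hs => by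
        rw [EllOne.truncate_apply, Set.indicator_of_notMem (by simp [hs])]
      simp only [Function.comp_apply, EllOne.fourierHom_apply]
      rw [EllOne.fourier_zero_eq _ hneg, Complex.ofReal_re,
        tsum_eq_sum (s := Finset.range (t + 1))]
      · exact Finset.sum_congr rfl fun s hs => htr t s (by simpa [Nat.lt_succ_iff] using hs)
      · intro s hs
        rw [EllOne.truncate_apply, Set.indicator_of_notMem]
        simp at hs ⊢
        omega
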